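/- Let $G$ be a finite directed graph with vertex set $V$, and fix $L\in\mathbb{N}$. For $S\subseteq V$, a matching of the induced subgraph $G[S]$ is a set of pairwise vertex-disjoint directed cycles of $G[S]$, each of length at most $L$; its size is the number of vertices on its cycles, and it is optimal if no matching of $G[S]$ has larger size. Let $k\ge 1$, and let each vertex of $G$ be owned by one of the players $1,\dots,k$; let $H_i$ be the subgraph of $G$ induced by the vertices of player $i$. A matching of $G$ is individually rational if, for every player $i$, it matches at least as many vertices of player $i$ as every matching of $H_i$ does. Fix an optimal matching $\mathrm{opt}(G)$ of $G$ and, for every induced subgraph $H$ of $G$, an optimal matching $\mathrm{opt}(H)$ of $H$ (all arbitrary, and all chosen independently of the ownership; such matchings exist). Write $|M|$ for the size of a matching $M$ and $|\mathrm{opt}(G)\restriction H_i|$ for the number of vertices of player $i$ that are matched by $\mathrm{opt}(G)$. The Veto mechanism $\mathcal{M}$ is defined by $\mathcal{M}(H_1,\dots,H_k)=\mathrm{opt}(G)$ if $|\mathrm{opt}(H_i)|\le|\mathrm{opt}(G)\restriction H_i|$ for all $i$, and $\mathcal{M}(H_1,\dots,H_k)=\bigcup_{i}\mathrm{opt}(H_i)$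 otherwise. Then $\mathcal{M}(H_1,\dots,H_k)$ is an individually rational matching of $G$ for every assignment of the vertices to the players. Moreover, there is a constant $C_L>0$ that depends only on $L$ such that, if the vertices are assigned to the players independently, each vertex to each player with probability $p_i=1/k$, then for every $\delta>0$ \[ \Pr\left[\,|\mathcal{M}(H_1,\dots,H_k)|\ \ge\ |\mathrm{opt}(G)|-C_L\,k\sqrt{|\mathrm{opt}(G)|\,\ln\frac{k}{\delta}}\,\right]\ \ge\ 1-\delta , \] where the square root of a negative number is read as $0$ (this occurs only for $\delta>k$, when the bound $1-\delta$ is negative). -/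

import Mathlib

namespace CycleMatching

section

variable {V : Type*} [DecidableEq V]

/-- `c` is a directed cycle of length at most `L` in the subgraph of `G` induced by the vertex
set `S`: a cyclic sequence of distinct vertices of `S`, at least one of them, in which every vertex
has an edge of `G` to the next one (the last one to the first one). A loop of `G`, if there is any,
is a cycle of length one; in a loopless graph all cycles have length at least two. -/
structure IsCycleIn (G : Digraph V) (L : ℕ) (S : Finset V) (c : Cycle V) : Prop where
  ne_nil : c ≠ Cycle.nil
  nodup : c.Nodup
  chain : c.Chain G.Adj
  length_le : c.length ≤ L
  subset : c.toFinset ⊆ S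

/-- `M` is a matching of the subgraph of `G` induced by `S`: a set of pairwise vertex-disjoint
directed cycles of length at most `L`. -/
structure IsMatching (G : Digraph V) (L : ℕ) (S : Finset V) (M : Finset (Cycle V)) : Prop where
  isCycleIn : ∀ c ∈ M, IsCycleIn G L S c
  disjoint : ∀ c ∈ M, ∀ d ∈ M, c ≠ d → Disjoint c.toFinset d.toFinset

/-- The set of vertices matched by `M`. -/
def matched (M : Finset (Cycle V)) : Finset V :=
  M.biUnion Cycle.toFinset

/-- `M` is an optimal (maximum cardinality) matching of the subgraph of `G` induced by `S`: no
matching of that subgraph matches more vertices. -/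
def IsOptimal (G : Digraph V) (L : ℕ) (S : Finset V) (M : Finset (Cycle V)) : Prop :=
  IsMatching G L S M ∧
    ∀ N : Finset (Cycle V), IsMatching G L S N → (matched N).card ≤ (matched M).card

/-- The vertices owned by player `i` when vertex `v` belongs to player `σ v`. -/
def owned [Fintype V] {k : ℕ} (σ : V → Fin k) (i : Fin k) : Finset V :=
  Finset.univ.filter fun v => σ v = i

/-- `M` is individually rational when the players own the vertex sets `H i`: every player has at
least as many of his own vertices matched by `M` as by any matching of his own subgraph. -/
def IsIndividuallyRational (G : Digraph V) (L : ℕ) {k : ℕ} (H : Fin k → Finset V)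
    (M : Finset (Cycle V)) : Prop :=
  ∀ i : Fin k, ∀ N : Finset (Cycle V), IsMatching G L (H i) N →
    (matched N).card ≤ (matched M ∩ H i).card

/-- The Veto mechanism: propose the fixed matching `M₀`; if some player has more vertices in his
internal matching `opt (H i)` than own vertices in `M₀`, use the union of all internal matchings. -/
def veto (M₀ : Finset (Cycle V)) (opt : Finset V → Finset (Cycle V)) {k : ℕ}
    (H : Fin k → Finset V) : Finset (Cycle V) :=
  if ∀ i : Fin k, (matched (opt (H i))).card ≤ (matched M₀ ∩ H i).card then M₀
  else Finset.univ.biUnion fun i => opt (H i)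

end

/-- The law of the random owner map: every vertex is given independently to one of the `k` players,
to each of them with probability `1 / k`. -/
noncomputable def ownerLaw (V : Type*) [Fintype V] (k : ℕ) [NeZero k] :
    MeasureTheory.Measure (V → Fin k) :=
  MeasureTheory.Measure.pi fun _ : V => (PMF.uniformOfFintype (Fin k)).toMeasure

end CycleMatching

namespace CycleMatching

/-! ### Concentration on product spaces, by Talagrand's method. -/

section Concentration

/-! Write `m` for the size of the optimal matching of the whole graph and `f i` for that of player
`i`'s internal optimum. The argument compares only means and fluctuations. The `f i` have a common
mean `μ` by symmetry between players, and player `i`'s share of the global optimum has mean `m / k`.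
Suppose all these quantities are within `t` of their means on the relevant side. If player `i`
vetoes, then `m / k - t ≤ f i ≤ μ + t`, so every `f j ≥ μ - t ≥ m / k - 3 * t`, and the fallback
loses at most `3 * k * t`. No direct estimate of `μ` is needed.

The fluctuations must scale with `√m`, not with the square root of the number of vertices, so a
bounded-difference inequality is not enough. But `f i` is certified by its at most `m` matched
vertices: reassigning one of them destroys at most one cycle, hence at most `L` matched vertices
(`IsMatching.card_matched_le`). Talagrand's convex distance inequality
(`sum_exp_mul_sum_exp_neg_le`) turns such certificates into sub-Gaussian tails around the mean
(`sum_exp_sub_mean_le`), and a union bound over players finishes (`ownerLaw_real_veto_ge`). -/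

theorem exists_exp_interpolation_le {u : ℝ} (hu : 0 < u) (hu1 : u ≤ 1) :
    ∃ θ : ℝ, 0 ≤ θ ∧ θ ≤ 1 ∧ Real.exp (-(1 - θ) * Real.log u + θ ^ 2 / 8) ≤ 2 - u := by
  by_cases h : u ≤ 1 / 2
  · refine ⟨1, zero_le_one, le_rfl, ?_⟩
    have h1 : (7 / 8 : ℝ) ≤ Real.exp (-(1 / 8)) := by
      have := Real.add_one_le_exp (-(1 / 8 : ℝ)); linarith
    rw [Real.exp_neg] at h1
    have h2 : Real.exp (1 / 8) ≤ (7 / 8 : ℝ)⁻¹ := by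
      rw [le_inv_comm₀ (Real.exp_pos _) (by norm_num)]; exact h1
    have h3 : -(1 - (1 : ℝ)) * Real.log u + 1 ^ 2 / 8 = 1 / 8 := by ring
    rw [h3]
    norm_num at h2
    linarith
  · push Not at h
    -- Not the exact minimiser `-4 * log u`, but agreeing with half of it to first order at `u = 1`
    -- and keeping all estimates rational.
    refine ⟨2 * (1 - u), by linarith, by linarith, ?_⟩
    have h2 : 0 < 2 - u := by linarith
    rw [← Real.le_log_iff_exp_le h2]
    have hl := Real.one_sub_inv_le_log_of_pos hu
    have hr := Real.le_log_one_add_of_nonneg (x := 1 - u) (by linarith)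
    rw [show 1 + (1 - u) = 2 - u by ring] at hr
    have h4 : (1 - u) - (1 - u) ^ 2 / 2 ≤ 2 * (1 - u) / (1 - u + 2) := by
      rw [le_div_iff₀ (by linarith)]
      nlinarith [pow_nonneg (sub_nonneg.2 hu1) 3]
    have h5 : -(1 - 2 * (1 - u)) * Real.log u ≤ (2 * u - 1) * (u⁻¹ - 1) := by
      nlinarith
    have h6 : (2 * u - 1) * (u⁻¹ - 1) ≤ (1 - u) - (1 - u) ^ 2 := by
      have : (1 - u) - (1 - u) ^ 2 - (2 * u - 1) * (u⁻¹ - 1) = (1 - u) ^ 3 / u := by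
        field_simp; ring
      have h7 : 0 ≤ (1 - u) ^ 3 / u := div_nonneg (pow_nonneg (sub_nonneg.2 hu1) 3) hu.le
      linarith
    nlinarith

/-- Hölder's inequality with exponents `1 / (1 - θ)` and `1 / θ`, from convexity of `exp` after
normalising the two sums by `a` and `b`. -/
theorem sum_exp_interpolation_le {ι : Type*} (s : Finset ι) (X Y : ι → ℝ) {a b θ : ℝ}
    (ha : 0 < a) (hb : 0 < b) (hX : ∑ i ∈ s, Real.exp (X i) ≤ a)
    (hY : ∑ i ∈ s, Real.exp (Y i) ≤ b) (h0 : 0 ≤ θ) (h1 : θ ≤ 1) :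
    ∑ i ∈ s, Real.exp ((1 - θ) * X i + θ * Y i) ≤
      Real.exp ((1 - θ) * Real.log a + θ * Real.log b) := by
  have key : ∀ i ∈ s, Real.exp ((1 - θ) * X i + θ * Y i) ≤
      Real.exp ((1 - θ) * Real.log a + θ * Real.log b) *
        ((1 - θ) * (Real.exp (X i) / a) + θ * (Real.exp (Y i) / b)) := by
    intro i _
    have hc := convexOn_exp.2 (Set.mem_univ (X i - Real.log a)) (Set.mem_univ (Y i - Real.log b))
      (sub_nonneg.2 h1) h0 (by ring)
    simp only [smul_eq_mul, Real.exp_sub, Real.exp_log ha, Real.exp_log hb] at hc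
    calc _ = Real.exp ((1 - θ) * Real.log a + θ * Real.log b) *
          Real.exp ((1 - θ) * (X i - Real.log a) + θ * (Y i - Real.log b)) := by
          rw [← Real.exp_add]; congr 1; ring
      _ ≤ _ := mul_le_mul_of_nonneg_left hc (Real.exp_pos _).le
  refine (Finset.sum_le_sum key).trans ?_
  rw [← Finset.mul_sum, Finset.sum_add_distrib, ← Finset.mul_sum, ← Finset.mul_sum,
    ← Finset.sum_div, ← Finset.sum_div]
  have hXa : (∑ i ∈ s, Real.exp (X i)) / a ≤ 1 := (div_le_one ha).2 hX
  have hYb : (∑ i ∈ s, Real.exp (Y i)) / b ≤ 1 := (div_le_one hb).2 hY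
  refine mul_le_of_le_one_right (Real.exp_pos _).le ?_
  nlinarith [sub_nonneg.2 h1]

theorem sum_fin_succ_arrow {Ω : Type*} [Fintype Ω] {n : ℕ} (F : (Fin (n + 1) → Ω) → ℝ) :
    ∑ y, F y = ∑ t : Ω, ∑ y : Fin n → Ω, F (Fin.cons t y) := by
  rw [← Fintype.sum_prod_type']
  exact (Fintype.sum_equiv (Fin.consEquiv fun _ : Fin (n + 1) => Ω) _ _ fun _ => rfl).symm

/-- A functional form of Talagrand's convex distance inequality, for the uniform measure on
`Fin n → Ω`. -/
theorem sum_exp_mul_sum_exp_neg_le_fin {Ω : Type*} [Fintype Ω] [DecidableEq Ω] [Nonempty Ω]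
    (n : ℕ) : ∀ (f g : (Fin n → Ω) → ℝ) (c : (Fin n → Ω) → Fin n → ℝ),
    (∀ x y, g y ≤ f x + ∑ i, if x i = y i then 0 else c y i) →
    (∑ y, Real.exp (g y - 2 * ∑ i, c y i ^ 2)) * ∑ x, Real.exp (-f x) ≤
      ((Fintype.card Ω : ℝ) ^ 2) ^ n := by
  induction n with
  | zero =>
    intro f g c h
    have := h default default
    simp only [Finset.univ_eq_empty, Finset.sum_empty] at this
    simp only [Finset.univ_unique, Finset.sum_singleton, ← Real.exp_add, pow_zero,
      Real.exp_le_one_iff, Finset.univ_eq_empty, Finset.sum_empty]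
    linarith
  | succ n ih =>
    intro f g c h
    set B : ℝ := ((Fintype.card Ω : ℝ) ^ 2) ^ n with hB
    have hBpos : 0 < B := by
      have : (0 : ℝ) < Fintype.card Ω := by exact_mod_cast Fintype.card_pos
      positivity
    let S : Ω → ℝ := fun t => ∑ x : Fin n → Ω, Real.exp (-f (Fin.cons t x))
    have hS : ∀ t, 0 < S t := fun t =>
      Finset.sum_pos (fun _ _ => Real.exp_pos _) Finset.univ_nonempty
    -- The heaviest slice is the best one to compare with. Points of slice `t` can be compared with
    -- slice `t` at no cost (`hX`) or with slice `s` at cost `c _ 0` (`hY`).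
    obtain ⟨s, hs⟩ := Finite.exists_max S
    let X : Ω → (Fin n → Ω) → ℝ := fun t y =>
      g (Fin.cons t y) - 2 * ∑ i : Fin n, c (Fin.cons t y) i.succ ^ 2
    have hX : ∀ t, ∑ y, Real.exp (X t y) ≤ B / S t := by
      intro t
      rw [le_div_iff₀ (hS t)]
      refine ih (fun x => f (Fin.cons t x)) (fun y => g (Fin.cons t y))
        (fun y i => c (Fin.cons t y) i.succ) fun x y => ?_
      have := h (Fin.cons t x) (Fin.cons t y)
      simpa [Fin.sum_univ_succ] using this
    have hY : ∀ t, t ≠ s → ∑ y, Real.exp (X t y - c (Fin.cons t y) 0) ≤ B / S s := by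
      intro t hts
      rw [le_div_iff₀ (hS s)]
      have := ih (fun x => f (Fin.cons s x)) (fun y => g (Fin.cons t y) - c (Fin.cons t y) 0)
        (fun y i => c (Fin.cons t y) i.succ) fun x y => by
          have := h (Fin.cons s x) (Fin.cons t y)
          simp only [Fin.sum_univ_succ, Fin.cons_zero, Fin.cons_succ, if_neg hts.symm] at this
          linarith
      refine le_of_eq_of_le ?_ this
      congr 1
      refine Finset.sum_congr rfl fun y _ => ?_
      congr 1
      simp only [X]; ring
    have hslice : ∀ t, ∑ y, Real.exp (X t y - 2 * c (Fin.cons t y) 0 ^ 2) ≤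
        B / S s * (2 - S t / S s) := by
      intro t
      -- `hY` is unavailable for `t = s`, but there the ratio is 1 and `hX` suffices.
      by_cases hts : t = s
      · subst hts
        rw [div_self (hS t).ne', show (2 : ℝ) - 1 = 1 by norm_num, mul_one]
        refine (Finset.sum_le_sum fun y _ => ?_).trans (hX t)
        rw [Real.exp_le_exp]
        nlinarith [sq_nonneg (c (Fin.cons t y) 0)]
      obtain ⟨θ, h0, h1, hθ⟩ := exists_exp_interpolation_le (div_pos (hS t) (hS s))
        ((div_le_one (hS s)).2 (hs t))
      have hi := sum_exp_interpolation_le Finset.univ (X t)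
        (fun y => X t y - c (Fin.cons t y) 0) (div_pos hBpos (hS t)) (div_pos hBpos (hS s))
        (hX t) (hY t hts) h0 h1
      calc _ ≤ ∑ y, Real.exp (θ ^ 2 / 8) *
            Real.exp ((1 - θ) * X t y + θ * (X t y - c (Fin.cons t y) 0)) := by
            refine Finset.sum_le_sum fun y _ => ?_
            rw [← Real.exp_add, Real.exp_le_exp]
            -- Completing the square, `2c² - θc + θ²/8 = (4c - θ)²/8`; this is where the weight 2 in
            -- the exponent meets `θ ^ 2 / 8`.
            nlinarith [sq_nonneg (4 * c (Fin.cons t y) 0 - θ)]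
        _ ≤ Real.exp (θ ^ 2 / 8) *
            Real.exp ((1 - θ) * Real.log (B / S t) + θ * Real.log (B / S s)) := by
            rw [← Finset.mul_sum]
            exact mul_le_mul_of_nonneg_left hi (Real.exp_pos _).le
        _ = B / S s * Real.exp (-(1 - θ) * Real.log (S t / S s) + θ ^ 2 / 8) := by
            rw [← Real.exp_log (div_pos hBpos (hS s)), ← Real.exp_add, ← Real.exp_add,
              Real.log_exp, Real.log_div hBpos.ne' (hS t).ne', Real.log_div hBpos.ne' (hS s).ne',
              Real.log_div (hS t).ne' (hS s).ne']
            congr 1; ring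
        _ ≤ _ := mul_le_mul_of_nonneg_left hθ (div_pos hBpos (hS s)).le
    have hsum : ∑ y, Real.exp (g y - 2 * ∑ i, c y i ^ 2) ≤
        B / S s * (2 * Fintype.card Ω - (∑ t, S t) / S s) := by
      rw [sum_fin_succ_arrow]
      calc _ = ∑ t, ∑ y, Real.exp (X t y - 2 * c (Fin.cons t y) 0 ^ 2) := by
            refine Finset.sum_congr rfl fun t _ => Finset.sum_congr rfl fun y _ => ?_
            simp only [X, Fin.sum_univ_succ]
            congr 1; ring
        _ ≤ ∑ t, B / S s * (2 - S t / S s) := Finset.sum_le_sum fun t _ => hslice t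
        _ = _ := by
            rw [← Finset.mul_sum, Finset.sum_sub_distrib, Finset.sum_div]
            simp [mul_comm]
    have htot : ∑ x, Real.exp (-f x) = ∑ t, S t := sum_fin_succ_arrow _
    rw [htot]
    have hT : 0 < ∑ t, S t := Finset.sum_pos (fun t _ => hS t) Finset.univ_nonempty
    refine (mul_le_mul_of_nonneg_right hsum hT.le).trans ?_
    have e : B / S s * (2 * Fintype.card Ω - (∑ t, S t) / S s) * ∑ t, S t =
        B * ((2 * Fintype.card Ω - (∑ t, S t) / S s) * ((∑ t, S t) / S s)) := by
      ring
    rw [e, pow_succ]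
    refine mul_le_mul_of_nonneg_left ?_ hBpos.le
    -- The bound `z * (2 * n - z) ≤ n ^ 2`, where `n` is the size of `Ω`.
    nlinarith [sq_nonneg ((Fintype.card Ω : ℝ) - (∑ t, S t) / S s)]

theorem sum_exp_mul_sum_exp_neg_le {V Ω : Type*} [Fintype V] [DecidableEq V] [Fintype Ω]
    [DecidableEq Ω] [Nonempty Ω] (f g : (V → Ω) → ℝ) (c : (V → Ω) → V → ℝ)
    (h : ∀ x y, g y ≤ f x + ∑ i, if x i = y i then 0 else c y i) :
    (∑ y, Real.exp (g y - 2 * ∑ i, c y i ^ 2)) * ∑ x, Real.exp (-f x) ≤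
      (Fintype.card (V → Ω) : ℝ) ^ 2 := by
  let e := Fintype.equivFin V
  let E : (Fin (Fintype.card V) → Ω) ≃ (V → Ω) := e.symm.arrowCongr (Equiv.refl Ω)
  have hE : ∀ x i, E x i = x (e i) := fun _ _ => rfl
  have key := sum_exp_mul_sum_exp_neg_le_fin (Fintype.card V) (fun x => f (E x))
    (fun y => g (E y)) (fun y i => c (E y) (e.symm i)) fun x y => by
      refine (h (E x) (E y)).trans_eq ?_
      congr 1
      exact Fintype.sum_equiv e _ _ fun i => by simp [hE]
  rw [← E.sum_comp, ← E.sum_comp fun x => Real.exp (-f x), Fintype.card_fun, Nat.cast_pow,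
    ← pow_mul, mul_comm (Fintype.card V), pow_mul]
  convert key using 7
  exact Fintype.sum_equiv e _ _ fun i => by simp

/-- A function certified by at most `m` coordinates, each of weight `a`, has sub-Gaussian
deviations from its mean `μ`. -/
theorem sum_exp_sub_mean_le {V Ω : Type*} [Fintype V] [DecidableEq V] [Fintype Ω]
    [DecidableEq Ω] [Nonempty Ω] {f : (V → Ω) → ℝ} {I : (V → Ω) → Finset V} {a m μ : ℝ}
    (hI : ∀ y, ((I y).card : ℝ) ≤ m)
    (hf : ∀ x y, f y ≤ f x + a * ((I y).filter fun v => x v ≠ y v).card)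
    (hμ : ∑ x, f x = Fintype.card (V → Ω) * μ) (l : ℝ) :
    ∑ x, Real.exp (l * (f x - μ)) ≤
      Fintype.card (V → Ω) * Real.exp (2 * (l ^ 2 * (a ^ 2 * m))) := by
  set N : ℝ := (Fintype.card (V → Ω) : ℝ) with hN
  have hNpos : 0 < N := by rw [hN]; exact_mod_cast Fintype.card_pos
  have jensen : ∀ l : ℝ, N ≤ ∑ x, Real.exp (l * (f x - μ)) := by
    intro l
    calc N = ∑ x, (l * (f x - μ) + 1) := by
          rw [Finset.sum_add_distrib, ← Finset.mul_sum, Finset.sum_sub_distrib, hμ]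
          simp [hN]
      _ ≤ _ := Finset.sum_le_sum fun x _ => Real.add_one_le_exp _
  have prod : ∀ l : ℝ, 0 ≤ l → (∑ x, Real.exp (l * (f x - μ))) *
      ∑ x, Real.exp (-l * (f x - μ)) ≤ N ^ 2 * Real.exp (2 * (l ^ 2 * (a ^ 2 * m))) := by
    intro l hl
    -- Both functions are the same centred one; the cost vector is `l * a` on the certificate, with
    -- squared norm at most `l ^ 2 * a ^ 2 * m`.
    have key := sum_exp_mul_sum_exp_neg_le (fun x => l * (f x - μ)) (fun x => l * (f x - μ))
      (fun y v => if v ∈ I y then l * a else 0) fun x y => by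
        have e : (∑ i, if x i = y i then 0 else if i ∈ I y then l * a else 0) =
            l * (a * ((I y).filter fun v => x v ≠ y v).card) := by
          rw [Finset.card_filter, Nat.cast_sum, Finset.mul_sum, Finset.mul_sum,
            ← Finset.sum_filter_add_sum_filter_not Finset.univ (· ∈ I y),
            Finset.sum_eq_zero (s := Finset.univ.filter (· ∉ I y)), add_zero]
          · simp only [Finset.filter_mem_eq_inter, Finset.univ_inter]
            refine Finset.sum_congr rfl fun i hi => ?_
            by_cases hxy : x i = y i <;> simp [hxy, hi]
          · intro i hi
            simp [(Finset.mem_filter.1 hi).2]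
        rw [e]
        nlinarith [hf x y]
    have lower : (∑ x, Real.exp (l * (f x - μ))) * Real.exp (-(2 * (l ^ 2 * (a ^ 2 * m)))) ≤
        ∑ y, Real.exp (l * (f y - μ) - 2 * ∑ v, (if v ∈ I y then l * a else 0) ^ 2) := by
      rw [Finset.sum_mul]
      refine Finset.sum_le_sum fun y _ => ?_
      rw [← Real.exp_add, Real.exp_le_exp]
      have e : (∑ v, (if v ∈ I y then l * a else 0) ^ 2) = (I y).card * (l * a) ^ 2 := by
        simp [ite_pow, Finset.sum_ite_mem]
      rw [e]
      nlinarith [mul_le_mul_of_nonneg_right (hI y) (sq_nonneg (l * a))]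
    have hpos : 0 ≤ ∑ x, Real.exp (-l * (f x - μ)) :=
      Finset.sum_nonneg fun _ _ => (Real.exp_pos _).le
    simp only [← neg_mul] at key
    have := (mul_le_mul_of_nonneg_right lower hpos).trans key
    rw [Real.exp_neg, mul_right_comm, ← div_eq_mul_inv, div_le_iff₀ (Real.exp_pos _)] at this
    exact this
  have prod' : (∑ x, Real.exp (l * (f x - μ))) * ∑ x, Real.exp (-l * (f x - μ)) ≤
      N ^ 2 * Real.exp (2 * (l ^ 2 * (a ^ 2 * m))) := by
    rcases le_total 0 l with hl | hl
    · exact prod l hl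
    · have := prod (-l) (neg_nonneg.2 hl)
      rw [neg_neg, neg_sq, mul_comm (∑ x, Real.exp (-l * (f x - μ)))] at this
      exact this
  -- Since the mean is `μ`, the factor with `-l` averages at least 1 and can be dropped from the
  -- product, which centres the bound at the mean rather than at a median.
  have hj := jensen (-l)
  have hnn : 0 ≤ ∑ x, Real.exp (l * (f x - μ)) :=
    Finset.sum_nonneg fun _ _ => (Real.exp_pos _).le
  have := (mul_le_mul_of_nonneg_left hj hnn).trans prod'
  refine le_of_mul_le_mul_right (this.trans_eq ?_) hNpos
  ring

theorem card_le_of_sum_exp_le {Ω : Type*} [Fintype Ω] {h : Ω → ℝ} {N Q t : ℝ}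
    (hQ : 0 < Q)
    (hexp : ∀ l : ℝ, ∑ x, Real.exp (l * h x) ≤ N * Real.exp (2 * (l ^ 2 * Q))) (ht : 0 ≤ t) :
    ((Finset.univ.filter fun x => t < h x).card : ℝ) ≤ N * Real.exp (-(t ^ 2 / (8 * Q))) := by
  -- The minimiser of the Chernoff exponent `2 * l ^ 2 * Q - l * t`.
  set l := t / (4 * Q) with hl
  have hl0 : 0 ≤ l := by positivity
  have h1 : ((Finset.univ.filter fun x => t < h x).card : ℝ) * Real.exp (l * t) ≤
      ∑ x, Real.exp (l * h x) := by
    rw [← nsmul_eq_mul]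
    refine (Finset.card_nsmul_le_sum _ (fun x => Real.exp (l * h x)) _ fun x hx => ?_).trans
      (Finset.sum_le_sum_of_subset_of_nonneg (Finset.filter_subset _ _)
        fun _ _ _ => (Real.exp_pos _).le)
    exact Real.exp_le_exp.2 (mul_le_mul_of_nonneg_left (Finset.mem_filter.1 hx).2.le hl0)
  have h2 := h1.trans (hexp l)
  rw [← le_div_iff₀ (Real.exp_pos _), mul_div_assoc, ← Real.exp_sub] at h2
  refine h2.trans_eq ?_
  congr 2
  rw [hl]; field_simp; ring

/-- Two-sided deviation bound for functions with certificates of bounded size. -/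
theorem card_deviation_le {V Ω : Type*} [Fintype V] [DecidableEq V] [Fintype Ω]
    [DecidableEq Ω] [Nonempty Ω] {f : (V → Ω) → ℝ} {I : (V → Ω) → Finset V} {a m μ t : ℝ}
    (ha : 0 < a) (hm : 0 < m) (hI : ∀ y, ((I y).card : ℝ) ≤ m)
    (hf : ∀ x y, f y ≤ f x + a * ((I y).filter fun v => x v ≠ y v).card)
    (hμ : ∑ x, f x = Fintype.card (V → Ω) * μ) (ht : 0 ≤ t) :
    ((Finset.univ.filter fun x => t < f x - μ).card : ℝ) ≤
        Fintype.card (V → Ω) * Real.exp (-(t ^ 2 / (8 * (a ^ 2 * m)))) ∧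
      ((Finset.univ.filter fun x => t < μ - f x).card : ℝ) ≤
        Fintype.card (V → Ω) * Real.exp (-(t ^ 2 / (8 * (a ^ 2 * m)))) := by
  have hs := sum_exp_sub_mean_le hI hf hμ
  refine ⟨card_le_of_sum_exp_le (by positivity) hs ht,
    card_le_of_sum_exp_le (by positivity) (fun l => ?_) ht⟩
  have := hs (-l)
  rw [neg_sq] at this
  refine le_of_eq_of_le (Finset.sum_congr rfl fun x _ => ?_) this
  congr 1; ring

/-- Union bound over three events for every index. -/
theorem card_exists_le {ι α : Type*} [Fintype ι] [Fintype α]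
    (P : ι → Fin 3 → α → Prop) [∀ i b, DecidablePred (P i b)]
    [DecidablePred fun x => ∃ i b, P i b x] {q : ℝ}
    (h : ∀ i b, ((Finset.univ.filter (P i b)).card : ℝ) ≤ q) :
    ((Finset.univ.filter fun x => ∃ i b, P i b x).card : ℝ) ≤ 3 * (Fintype.card ι * q) := by
  classical
  have hsub : (Finset.univ.filter fun x => ∃ i b, P i b x) ⊆
      (Finset.univ : Finset (ι × Fin 3)).biUnion fun p => Finset.univ.filter (P p.1 p.2) := by
    intro x hx
    obtain ⟨i, b, hib⟩ := (Finset.mem_filter.1 hx).2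
    exact Finset.mem_biUnion.2 ⟨(i, b), Finset.mem_univ _, by simpa using hib⟩
  calc _ ≤ ∑ p : ι × Fin 3, ((Finset.univ.filter (P p.1 p.2)).card : ℝ) := by
        exact_mod_cast (Finset.card_le_card hsub).trans Finset.card_biUnion_le
    _ ≤ ∑ _p : ι × Fin 3, q := Finset.sum_le_sum fun p _ => h p.1 p.2
    _ = _ := by simp; ring

end Concentration

/-! ### Stability of optimal matchings under deletion of vertices. -/

section Matching

variable {V : Type*} [DecidableEq V] {G : Digraph V} {L : ℕ}

theorem IsCycleIn.mono {S T : Finset V} {c : Cycle V} (h : IsCycleIn G L S c) (hST : S ⊆ T) :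
    IsCycleIn G L T c :=
  ⟨h.ne_nil, h.nodup, h.chain, h.length_le, h.subset.trans hST⟩

theorem IsMatching.mono {S T : Finset V} {M : Finset (Cycle V)} (h : IsMatching G L S M)
    (hST : S ⊆ T) : IsMatching G L T M :=
  ⟨fun c hc => (h.isCycleIn c hc).mono hST, h.disjoint⟩

theorem IsMatching.matched_subset {S : Finset V} {M : Finset (Cycle V)}
    (h : IsMatching G L S M) : matched M ⊆ S :=
  Finset.biUnion_subset.2 fun c hc => (h.isCycleIn c hc).subset

theorem IsCycleIn.card_toFinset_le {S : Finset V} {c : Cycle V} (h : IsCycleIn G L S c) :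
    c.toFinset.card ≤ L := by
  refine le_trans ?_ h.length_le
  induction c using Quotient.inductionOn with
  | h l => simpa using List.toFinset_card_le l

theorem exists_isOptimal (G : Digraph V) (L : ℕ) (S : Finset V) : ∃ M, IsOptimal G L S M := by
  let A : Set ℕ := {n | ∃ M, IsMatching G L S M ∧ (matched M).card = n}
  have hne : A.Nonempty := ⟨0, ∅, ⟨by simp, by simp⟩, by simp [matched]⟩
  have hb : BddAbove A := by
    refine ⟨S.card, ?_⟩
    rintro _ ⟨M, hM, rfl⟩
    exact Finset.card_le_card hM.matched_subset
  obtain ⟨M, hM, hc⟩ := Nat.sSup_mem hne hb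
  exact ⟨M, hM, fun N hN => hc ▸ le_csSup hb ⟨N, hN, rfl⟩⟩

/-- Removing the vertices of `S` outside `T` destroys at most one cycle per matched vertex. -/
theorem IsMatching.card_matched_le {S T : Finset V} {M N : Finset (Cycle V)}
    (hM : IsMatching G L S M) (hN : IsOptimal G L T N) :
    (matched M).card ≤ (matched N).card + L * (matched M \ T).card := by
  let M' := M.filter fun c => c.toFinset ⊆ T
  have hM' : IsMatching G L T M' := by
    refine ⟨fun c hc => ?_, fun c hc d hd => hM.disjoint c (Finset.mem_filter.1 hc).1 d
      (Finset.mem_filter.1 hd).1⟩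
    have h := hM.isCycleIn c (Finset.mem_filter.1 hc).1
    exact ⟨h.ne_nil, h.nodup, h.chain, h.length_le, (Finset.mem_filter.1 hc).2⟩
  -- The cycle through a matched vertex, unique by disjointness; `Cycle.nil` is a dummy value
  -- elsewhere.
  have hex : ∀ v, ∃ c : Cycle V, v ∈ matched M → c ∈ M ∧ v ∈ c.toFinset := by
    intro v
    by_cases hv : v ∈ matched M
    · obtain ⟨c, hc, hvc⟩ := Finset.mem_biUnion.1 hv
      exact ⟨c, fun _ => ⟨hc, hvc⟩⟩
    · exact ⟨Cycle.nil, fun h => absurd h hv⟩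
  choose cyc hcyc using hex
  have hsub : matched M ⊆ matched M' ∪ (matched M \ T).biUnion fun v => (cyc v).toFinset := by
    intro v hv
    obtain ⟨c, hc, hvc⟩ := Finset.mem_biUnion.1 hv
    by_cases hcT : c.toFinset ⊆ T
    · exact Finset.mem_union_left _ (Finset.mem_biUnion.2 ⟨c, Finset.mem_filter.2 ⟨hc, hcT⟩, hvc⟩)
    · obtain ⟨w, hwc, hwT⟩ := Finset.not_subset.1 hcT
      have hw : w ∈ matched M := Finset.mem_biUnion.2 ⟨c, hc, hwc⟩
      have hcw : c = cyc w := by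
        by_contra hne
        exact Finset.disjoint_left.1 (hM.disjoint c hc _ (hcyc w hw).1 hne) hwc (hcyc w hw).2
      exact Finset.mem_union_right _ (Finset.mem_biUnion.2
        ⟨w, Finset.mem_sdiff.2 ⟨hw, hwT⟩, hcw ▸ hvc⟩)
  calc (matched M).card ≤ (matched M').card +
        ((matched M \ T).biUnion fun v => (cyc v).toFinset).card :=
        (Finset.card_le_card hsub).trans (Finset.card_union_le _ _)
    _ ≤ (matched N).card + (matched M \ T).card * L := by
        refine add_le_add (hN.2 _ hM') (Finset.card_biUnion_le_card_mul _ _ _ fun v hv => ?_)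
        exact (hM.isCycleIn _ (hcyc v (Finset.mem_sdiff.1 hv).1).1).card_toFinset_le
    _ = _ := by rw [mul_comm]

end Matching

/-! ### The Veto mechanism: individual rationality and loss. -/

section Veto

theorem mem_owned {V : Type*} [Fintype V] {k : ℕ} {σ : V → Fin k} {i : Fin k} {v : V} :
    v ∈ owned σ i ↔ σ v = i := by
  simp [owned]

theorem disjoint_owned {V : Type*} [Fintype V] {k : ℕ} (σ : V → Fin k)
    {i j : Fin k} (hij : i ≠ j) : Disjoint (owned σ i) (owned σ j) :=
  Finset.disjoint_left.2 fun _ hi hj => hij ((mem_owned.1 hi).symm.trans (mem_owned.1 hj))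

variable {V : Type*} [Fintype V] [DecidableEq V] {G : Digraph V} {L k : ℕ}
  {M₀ : Finset (Cycle V)} {opt : Finset V → Finset (Cycle V)}

theorem matched_biUnion_opt (σ : V → Fin k) :
    matched (Finset.univ.biUnion fun i => opt (owned σ i)) =
      Finset.univ.biUnion fun i => matched (opt (owned σ i)) := by
  simp only [matched, Finset.biUnion_biUnion]

theorem card_matched_biUnion_opt (hopt : ∀ S, IsOptimal G L S (opt S)) (σ : V → Fin k) :
    (matched (Finset.univ.biUnion fun i => opt (owned σ i))).card =
      ∑ i, (matched (opt (owned σ i))).card := by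
  rw [matched_biUnion_opt]
  exact Finset.card_biUnion fun i _ j _ hij =>
    (disjoint_owned σ hij).mono (hopt _).1.matched_subset (hopt _).1.matched_subset

theorem isMatching_biUnion_opt (hopt : ∀ S, IsOptimal G L S (opt S)) (σ : V → Fin k) :
    IsMatching G L Finset.univ (Finset.univ.biUnion fun i => opt (owned σ i)) := by
  constructor
  · intro c hc
    obtain ⟨i, -, hi⟩ := Finset.mem_biUnion.1 hc
    exact ((hopt _).1.isCycleIn c hi).mono (Finset.subset_univ _)
  · intro c hc d hd hcd
    obtain ⟨i, -, hi⟩ := Finset.mem_biUnion.1 hc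
    obtain ⟨j, -, hj⟩ := Finset.mem_biUnion.1 hd
    by_cases hij : i = j
    · subst hij
      exact (hopt _).1.disjoint c hi d hj hcd
    · exact (disjoint_owned σ hij).mono ((hopt _).1.isCycleIn c hi).subset
        ((hopt _).1.isCycleIn d hj).subset

theorem isMatching_veto (hM₀ : IsOptimal G L Finset.univ M₀)
    (hopt : ∀ S, IsOptimal G L S (opt S)) (σ : V → Fin k) :
    IsMatching G L Finset.univ (veto M₀ opt (owned σ)) := by
  unfold veto
  split_ifs
  · exact hM₀.1
  · exact isMatching_biUnion_opt hopt σ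

theorem isIndividuallyRational_veto (hopt : ∀ S, IsOptimal G L S (opt S)) (σ : V → Fin k) :
    IsIndividuallyRational G L (owned σ) (veto M₀ opt (owned σ)) := by
  intro i N hN
  refine ((hopt _).2 N hN).trans ?_
  unfold veto
  split_ifs with h
  · exact h i
  · rw [matched_biUnion_opt]
    exact Finset.card_le_card (Finset.subset_inter
      (Finset.subset_biUnion_of_mem (fun i => matched (opt (owned σ i))) (Finset.mem_univ i))
      (hopt _).1.matched_subset)

/-- Swapping two players is a bijection of owner maps, and `φ` sees only the vertex set. This is
where the choice of `opt` must not depend on the ownership. -/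
theorem sum_card_opt_eq [NeZero k] (φ : Finset V → ℝ) (i j : Fin k) :
    ∑ σ : V → Fin k, φ (owned σ i) = ∑ σ : V → Fin k, φ (owned σ j) := by
  refine Fintype.sum_equiv ((Equiv.refl V).arrowCongr (Equiv.swap i j)) _ _ fun σ => ?_
  congr 1
  ext v
  simp only [mem_owned, Equiv.arrowCongr_apply, Function.comp_apply, Equiv.refl_symm,
    Equiv.refl_apply]
  rw [Equiv.swap_apply_eq_iff, Equiv.swap_apply_right]

theorem sum_card_inter_owned [NeZero k] (A : Finset V) (i : Fin k) :
    ∑ σ : V → Fin k, ((A ∩ owned σ i).card : ℝ) =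
      Fintype.card (V → Fin k) * ((A.card : ℝ) / k) := by
  have hk : (k : ℝ) ≠ 0 := Nat.cast_ne_zero.2 (NeZero.ne k)
  have h1 : ∑ j : Fin k, ∑ σ : V → Fin k, ((A ∩ owned σ j).card : ℝ) =
      Fintype.card (V → Fin k) * A.card := by
    rw [Finset.sum_comm]
    have : ∀ σ : V → Fin k, ∑ j, ((A ∩ owned σ j).card : ℝ) = A.card := by
      intro σ
      rw [← Nat.cast_sum, Finset.card_eq_sum_card_fiberwise (f := σ) (t := Finset.univ)
        (fun _ _ => Finset.mem_coe.2 (Finset.mem_univ _))]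
      congr 1
      refine Finset.sum_congr rfl fun j _ => congrArg _ ?_
      ext v; simp [mem_owned]
    simp [this]
  have h2 : ∑ j : Fin k, ∑ σ : V → Fin k, ((A ∩ owned σ j).card : ℝ) =
      k * ∑ σ : V → Fin k, ((A ∩ owned σ i).card : ℝ) := by
    rw [Finset.sum_congr rfl fun j _ => sum_card_opt_eq (fun S => ((A ∩ S).card : ℝ)) j i]
    simp
  rw [h2] at h1
  field_simp
  linarith

/-- Each owner map has the same mass, so probabilities reduce to counting. -/
theorem ownerLaw_real_apply [NeZero k] (s : Set (V → Fin k)) [DecidablePred (· ∈ s)] :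
    (ownerLaw V k).real s =
      ((Finset.univ.filter (· ∈ s)).card : ℝ) / Fintype.card (V → Fin k) := by
  have hs : s = ((Finset.univ.filter (· ∈ s) : Finset (V → Fin k)) : Set (V → Fin k)) := by
    ext; simp
  have hprob : MeasureTheory.IsProbabilityMeasure (ownerLaw V k) := by
    unfold ownerLaw; infer_instance
  have hsing : ∀ σ : V → Fin k, (ownerLaw V k).real {σ} = (Fintype.card (V → Fin k) : ℝ)⁻¹ := by
    intro σ
    rw [MeasureTheory.measureReal_def, ownerLaw, MeasureTheory.Measure.pi_singleton]
    simp [PMF.uniformOfFintype_apply, ENNReal.toReal_inv]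
  conv_lhs => rw [hs]
  rw [← MeasureTheory.sum_measureReal_singleton]
  simp [hsing, div_eq_mul_inv]

/-- A vetoing player `i` links the two means: `m / k - t ≤ μ + t`, with `m` the size of `M₀`. The
third `t` is the downward deviation of each other internal optimum. -/
theorem card_matched_veto_ge [NeZero k] (hopt : ∀ S, IsOptimal G L S (opt S))
    (σ : V → Fin k) {μ t : ℝ} (ht : 0 ≤ t)
    (hup : ∀ i, ((matched (opt (owned σ i))).card : ℝ) - μ ≤ t)
    (hlow : ∀ i, μ - (matched (opt (owned σ i))).card ≤ t)
    (hM₀ : ∀ i, ((matched M₀).card : ℝ) / k - (matched M₀ ∩ owned σ i).card ≤ t) :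
    ((matched M₀).card : ℝ) - 3 * (k * t) ≤ (matched (veto M₀ opt (owned σ))).card := by
  have hk : (0 : ℝ) < k := Nat.cast_pos.2 (NeZero.pos k)
  unfold veto
  split_ifs with h
  · have := mul_nonneg hk.le ht
    linarith
  · push Not at h
    obtain ⟨i, hi⟩ := h
    have hi' : ((matched M₀ ∩ owned σ i).card : ℝ) ≤ (matched (opt (owned σ i))).card := by
      exact_mod_cast hi.le
    rw [card_matched_biUnion_opt hopt, Nat.cast_sum]
    calc ((matched M₀).card : ℝ) - 3 * (k * t) =
          ∑ _j : Fin k, (((matched M₀).card : ℝ) / k - 3 * t) := by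
          simp; field_simp
      _ ≤ _ := Finset.sum_le_sum fun j _ => by linarith [hup i, hlow j, hM₀ i]

theorem card_matched_veto_of_subsingleton (hM₀ : IsOptimal G L Finset.univ M₀)
    (hopt : ∀ S, IsOptimal G L S (opt S)) (σ : V → Fin 1) :
    (matched M₀).card ≤ (matched (veto M₀ opt (owned σ))).card := by
  have hσ : owned σ 0 = Finset.univ := by
    ext v; simp [mem_owned, Subsingleton.elim (σ v) 0]
  unfold veto
  split_ifs
  · exact le_rfl
  · rw [card_matched_biUnion_opt hopt, Fin.sum_univ_one, hσ]
    exact (hopt _).2 _ hM₀.1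

/-- The matched vertices under `y` are the certificate: those lost under `x` have changed owner. The
factor `L + 1` in place of `L` keeps the weight positive when `L = 0`. -/
theorem card_matched_opt_le (hopt : ∀ S, IsOptimal G L S (opt S)) (x y : V → Fin k) (i : Fin k) :
    ((matched (opt (owned y i))).card : ℝ) ≤ (matched (opt (owned x i))).card +
      (L + 1) * ((matched (opt (owned y i))).filter fun v => x v ≠ y v).card := by
  have h := (hopt (owned y i)).1.card_matched_le (hopt (owned x i))
  have hsub : matched (opt (owned y i)) \ owned x i ⊆
      (matched (opt (owned y i))).filter fun v => x v ≠ y v := by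
    intro v hv
    obtain ⟨hv, hx⟩ := Finset.mem_sdiff.1 hv
    have hy := mem_owned.1 ((hopt _).1.matched_subset hv)
    exact Finset.mem_filter.2 ⟨hv, fun e => hx (mem_owned.2 (e.trans hy))⟩
  have h' := h.trans (Nat.add_le_add_left
    (Nat.mul_le_mul (Nat.le_succ L) (Finset.card_le_card hsub)) _)
  exact_mod_cast h'

/-- Weight 1 would do; `L + 1` gives both families of events the same tail bound. -/
theorem card_inter_owned_le (A : Finset V) (L : ℕ) (x y : V → Fin k) (i : Fin k) :
    ((A ∩ owned y i).card : ℝ) ≤ (A ∩ owned x i).card +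
      (L + 1) * (A.filter fun v => x v ≠ y v).card := by
  have hsub : A ∩ owned y i ⊆ (A ∩ owned x i) ∪ A.filter fun v => x v ≠ y v := by
    intro v hv
    obtain ⟨hA, hy⟩ := Finset.mem_inter.1 hv
    by_cases e : x v = y v
    · exact Finset.mem_union_left _
        (Finset.mem_inter.2 ⟨hA, mem_owned.2 (e.trans (mem_owned.1 hy))⟩)
    · exact Finset.mem_union_right _ (Finset.mem_filter.2 ⟨hA, e⟩)
  have h : (A ∩ owned y i).card ≤ (A ∩ owned x i).card +
      (L + 1) * (A.filter fun v => x v ≠ y v).card :=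
    ((Finset.card_le_card hsub).trans (Finset.card_union_le _ _)).trans
      (Nat.add_le_add_left (Nat.le_mul_of_pos_left _ L.succ_pos) _)
  exact_mod_cast h

theorem ownerLaw_real_veto_ge [NeZero k] (hM₀ : IsOptimal G L Finset.univ M₀)
    (hopt : ∀ S, IsOptimal G L S (opt S)) {δ : ℝ} (hδ : 0 < δ) :
    1 - δ ≤ (ownerLaw V k).real
      {σ : V → Fin k | ((matched M₀).card : ℝ)
          - 15 * ((L : ℝ) + 1) * (k * √((matched M₀).card * Real.log (k / δ)))
        ≤ ((matched (veto M₀ opt (owned σ))).card : ℝ)} := by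
  classical
  set m : ℝ := ((matched M₀).card : ℝ)
  set N : ℝ := (Fintype.card (V → Fin k) : ℝ) with hN
  have hNpos : 0 < N := by rw [hN]; exact_mod_cast Fintype.card_pos
  have hkpos : (0 : ℝ) < k := Nat.cast_pos.2 (NeZero.pos k)
  -- The factor 5 makes the tail exponent `25 / 8 * log (k / δ)`, and `25 / 8 ≥ 3` bounds each tail
  -- by `(δ / k) ^ 3`.
  set t : ℝ := 5 * ((L : ℝ) + 1) * √(m * Real.log (k / δ)) with ht
  have ht0 : 0 ≤ t := by positivity
  have ht3 : 15 * ((L : ℝ) + 1) * (k * √(m * Real.log (k / δ))) = 3 * (k * t) := by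
    rw [ht]; ring
  rw [ht3]
  rcases le_or_gt 1 δ with hδ1 | hδ1
  · exact (sub_nonpos.2 hδ1).trans MeasureTheory.measureReal_nonneg
  suffices hbad : ∃ bad : Finset (V → Fin k), (bad.card : ℝ) ≤ N * δ ∧
      ∀ σ ∉ bad, m - 3 * (k * t) ≤ (matched (veto M₀ opt (owned σ))).card by
    obtain ⟨bad, hcard, hgood⟩ := hbad
    rw [ownerLaw_real_apply, le_div_iff₀ hNpos]
    have h1 : (badᶜ.card : ℝ) ≤ ((Finset.univ.filter (· ∈ {σ : V → Fin k |
        m - 3 * (k * t) ≤ ((matched (veto M₀ opt (owned σ))).card : ℝ)})).card : ℝ) := by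
      refine Nat.cast_le.2 (Finset.card_le_card fun σ hσ => ?_)
      exact Finset.mem_filter.2 ⟨Finset.mem_univ _, hgood σ (Finset.mem_compl.1 hσ)⟩
    have h2 : (bad.card : ℝ) + badᶜ.card = N := by
      rw [hN]; exact_mod_cast Finset.card_add_card_compl bad
    linarith
  have hempty : (((∅ : Finset (V → Fin k)).card : ℕ) : ℝ) ≤ N * δ := by
    simpa using (mul_pos hNpos hδ).le
  have hm0 : 0 ≤ m := Nat.cast_nonneg _
  rcases hm0.eq_or_lt with hmz | hmpos
  · refine ⟨∅, hempty, fun σ _ => ?_⟩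
    have h1 := mul_nonneg hkpos.le ht0
    have h2 : (0 : ℝ) ≤ (matched (veto M₀ opt (owned σ))).card := Nat.cast_nonneg _
    linarith
  -- One player is treated apart: the union bound ends in `3 * δ ^ 2 ≤ k ^ 2`, which for `δ` near 1
  -- needs `k ≥ 2`.
  rcases (Nat.one_le_iff_ne_zero.2 (NeZero.ne k)).eq_or_lt with hk1 | hk2
  · subst hk1
    refine ⟨∅, hempty, fun σ _ => ?_⟩
    have h1 := mul_nonneg hkpos.le ht0
    have h2 : m ≤ (matched (veto M₀ opt (owned σ))).card :=
      Nat.cast_le.2 (card_matched_veto_of_subsingleton hM₀ hopt σ)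
    linarith
  have hk2' : (2 : ℝ) ≤ k := by exact_mod_cast hk2
  set μ : ℝ := (∑ σ : V → Fin k, ((matched (opt (owned σ 0))).card : ℝ)) / N with hμ
  have hLpos : (0 : ℝ) < (L : ℝ) + 1 := by positivity
  have hsum : ∀ i : Fin k, ∑ σ : V → Fin k, ((matched (opt (owned σ i))).card : ℝ) = N * μ := by
    intro i
    rw [hμ, mul_div_cancel₀ _ hNpos.ne']
    exact sum_card_opt_eq (fun S => ((matched (opt S)).card : ℝ)) i 0
  have hdev := fun i : Fin k => card_deviation_le
    (f := fun σ : V → Fin k => ((matched (opt (owned σ i))).card : ℝ))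
    (I := fun σ => matched (opt (owned σ i))) hLpos hmpos
    (fun σ => Nat.cast_le.2 (hM₀.2 _ ((hopt _).1.mono (Finset.subset_univ _))))
    (fun x y => card_matched_opt_le hopt x y i) (hsum i) ht0
  have hdev₀ := fun i : Fin k => card_deviation_le
    (f := fun σ : V → Fin k => ((matched M₀ ∩ owned σ i).card : ℝ))
    (I := fun _ => matched M₀) hLpos hmpos (fun _ => le_rfl)
    (fun x y => card_inter_owned_le (matched M₀) L x y i) (sum_card_inter_owned _ i) ht0
  -- The bad events for player `i`: internal optimum too large, internal optimum too small, share of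
  -- `M₀` too small.
  let P : Fin k → Fin 3 → (V → Fin k) → Prop := fun i => ![
    fun σ => t < ((matched (opt (owned σ i))).card : ℝ) - μ,
    fun σ => t < μ - (matched (opt (owned σ i))).card,
    fun σ => t < m / k - (matched M₀ ∩ owned σ i).card]
  have hP : ∀ i b, DecidablePred (P i b) := fun _ _ => Classical.decPred _
  refine ⟨Finset.univ.filter fun σ => ∃ i b, P i b σ, ?_, fun σ hσ => ?_⟩
  · refine (card_exists_le P (q := N * Real.exp (-(t ^ 2 / (8 * (((L : ℝ) + 1) ^ 2 * m)))))
      fun i b => ?_).trans ?_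
    · fin_cases b
      · convert (hdev i).1 using 4
        exact Iff.rfl
      · convert (hdev i).2 using 4
        exact Iff.rfl
      · convert (hdev₀ i).2 using 4
        exact Iff.rfl
    have hlog : 0 ≤ Real.log (k / δ) :=
      Real.log_nonneg ((one_le_div hδ).2 (by linarith))
    have hexp : Real.exp (-(t ^ 2 / (8 * (((L : ℝ) + 1) ^ 2 * m)))) ≤ (δ / k) ^ 3 := by
      have e : t ^ 2 / (8 * (((L : ℝ) + 1) ^ 2 * m)) = 25 / 8 * Real.log (k / δ) := by
        rw [ht, mul_pow, Real.sq_sqrt (mul_nonneg hmpos.le hlog)]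
        field_simp
        ring
      rw [e, ← Real.le_log_iff_exp_le (by positivity), Real.log_pow,
        ← inv_div (k : ℝ) δ, Real.log_inv]
      push_cast
      linarith
    calc 3 * ((Fintype.card (Fin k) : ℝ) *
          (N * Real.exp (-(t ^ 2 / (8 * (((L : ℝ) + 1) ^ 2 * m)))))) ≤
          3 * (k * (N * (δ / k) ^ 3)) := by
          rw [Fintype.card_fin]
          gcongr
      _ = N * δ * (3 * δ ^ 2 / k ^ 2) := by field_simp
      _ ≤ N * δ := by
          refine mul_le_of_le_one_right (by positivity) ?_
          rw [div_le_one (by positivity)]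
          nlinarith
  · have hgood : ∀ i b, ¬ P i b σ := by simpa using hσ
    exact card_matched_veto_ge hopt σ ht0 (fun i => not_lt.1 (hgood i 0))
      (fun i => not_lt.1 (hgood i 1)) fun i => not_lt.1 (hgood i 2)

end Veto

end CycleMatching

theorem corollary1 (L : ℕ) :
    ∃ C : ℝ, 0 < C ∧
      ∀ (V : Type*) [Fintype V] [DecidableEq V] (G : Digraph V) (k : ℕ) [NeZero k],
        -- optimal matchings exist, on the whole graph and on every induced subgraph
        (∃ M₀, CycleMatching.IsOptimal G L Finset.univ M₀) ∧
        (∃ opt : Finset V → Finset (Cycle V), ∀ S, CycleMatching.IsOptimal G L S (opt S)) ∧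
        -- whichever are chosen, the Veto mechanism has the two properties
        ∀ (M₀ : Finset (Cycle V)) (opt : Finset V → Finset (Cycle V)),
          CycleMatching.IsOptimal G L Finset.univ M₀ →
          (∀ S : Finset V, CycleMatching.IsOptimal G L S (opt S)) →
          (∀ σ : V → Fin k,
            CycleMatching.IsMatching G L Finset.univ
              (CycleMatching.veto M₀ opt (CycleMatching.owned σ)) ∧
            CycleMatching.IsIndividuallyRational G L (CycleMatching.owned σ)
              (CycleMatching.veto M₀ opt (CycleMatching.owned σ))) ∧
          ∀ δ : ℝ, 0 < δ →
            1 - δ ≤ (CycleMatching.ownerLaw V k).real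
              {σ : V → Fin k |
                ((CycleMatching.matched M₀).card : ℝ)
                    - C * (k * √((CycleMatching.matched M₀).card * Real.log (k / δ)))
                  ≤ ((CycleMatching.matched
                      (CycleMatching.veto M₀ opt (CycleMatching.owned σ))).card : ℝ)} := by
  refine ⟨15 * ((L : ℝ) + 1), by positivity, fun V _ _ G k _ => ⟨?_, ?_, ?_⟩⟩
  · exact CycleMatching.exists_isOptimal G L Finset.univ
  · exact Classical.axiomOfChoice fun S => CycleMatching.exists_isOptimal G L S
  · intro M₀ opt hM₀ hopt
    exact ⟨fun σ => ⟨CycleMatching.isMatching_veto hM₀ hopt σ,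
      CycleMatching.isIndividuallyRational_veto hopt σ⟩,
      fun δ hδ => CycleMatching.ownerLaw_real_veto_ge hM₀ hopt hδ⟩
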